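/- All varieties are varieties of monoids. For a semigroup $S$, let $S^1$ be the monoid obtained from $S$ by adjoining a new identity element. Let $\mathbb A^1$ and $\mathbb E^1$ be the monoid varieties generated by the monoids $A^1$ and $E^1$ respectively, where $A$ and $E$ are the semigroups with zero \[ A=\langle a,b,c\mid a^2=a,\ b^2=b,\ ab=ca=0,\ ac=cb=c\rangle=\{a,b,c,ba,bc,0\}, \] \[ E=\langle a,b,c\mid a^2=ab=0,\ ba=ca=a,\ b^2=bc=b,\ c^2=cb=c\rangle=\{a,b,c,ac,0\}. \] Let $\mathbb E^1\{\sigma_2\}$ be the variety of all monoids satisfying the identities \[ xtx\approx xtx^2\approx x^2tx,\qquad xy^2x\approx x^2y^2,\qquad b\,t_2\,a\,t_1\,a^2b^2\approx b\,t_2\,a\,t_1\,b^2a^2 . \] Then every monoid variety $\mathbb V$ with \[ \mathbb A^1\vee\mathbb E^1\{\sigma_2\}\ \subseteq\ \mathbb V\ \subseteq\ \mathbb A^1\vee\mathbb E^1, \] where $\vee$ denotes the join in the lattice of monoid varieties, is non-finitely based: there is no finite set of identities such that $\mathbb V$ is the class of all monoids satisfying them. -/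

import Mathlib

universe u

namespace MonVar

/-! ### Words, identities, satisfaction -/

/-- Words over a countably infinite alphabet: elements of the free monoid on `ℕ`. -/
abbrev Word : Type := FreeMonoid ℕ

/-- The letter with index `i`, as a word. -/
def letter (i : ℕ) : Word := FreeMonoid.of i

/-- A monoid identity `u ≈ v`, represented by the pair `(u, v)`. -/
abbrev Identity : Type := Word × Word

/-- The monoid `M` satisfies the identity `u ≈ v`: both sides take the same value under every
substitution of elements of `M` for letters. -/
def Satisfies (M : Type u) [Monoid M] (e : Identity) : Prop :=
  ∀ φ : Word →* M, φ e.1 = φ e.2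

/-! ### Varieties of monoids -/

/-- A variety of monoids: a class of monoids closed under homomorphic images, submonoids (up to
isomorphism) and arbitrary direct products. -/
@[ext]
structure MonoidVariety where
  /-- `V.Mem M` says that the monoid `M` belongs to the variety `V`. -/
  Mem : ∀ (M : Type u) [Monoid M], Prop
  image_mem : ∀ {M N : Type u} [Monoid M] [Monoid N] (f : M →* N),
    Function.Surjective f → Mem M → Mem N
  sub_mem : ∀ {M N : Type u} [Monoid M] [Monoid N] (f : M →* N),
    Function.Injective f → Mem N → Mem M
  pi_mem : ∀ {ι : Type u} (M : ι → Type u) [∀ i, Monoid (M i)],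
    (∀ i, Mem (M i)) → Mem (∀ i, M i)

namespace MonoidVariety

/-- Varieties are ordered by inclusion. -/
instance : PartialOrder MonoidVariety.{u} where
  le V W := ∀ (M : Type u) [Monoid M], V.Mem M → W.Mem M
  le_refl _ _ _ h := h
  le_trans _ _ _ h₁ h₂ M _ h := h₂ M (h₁ M h)
  le_antisymm V W h₁ h₂ := by
    ext M inst
    exact ⟨h₁ M, h₂ M⟩

/-- The variety generated by a class `K` of monoids: the least variety containing `K`, that is, the
intersection of all varieties containing `K`. -/
def generatedBy (K : ∀ (M : Type u) [Monoid M], Prop) : MonoidVariety.{u} where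
  Mem M _ := ∀ W : MonoidVariety.{u}, (∀ (N : Type u) [Monoid N], K N → W.Mem N) → W.Mem M
  image_mem f hf h W hW := W.image_mem f hf (h W hW)
  sub_mem f hf h W hW := W.sub_mem f hf (h W hW)
  pi_mem M _ h W hW := W.pi_mem M fun i => h i W hW

/-- The join `V ⊔ W` is the least variety containing both `V` and `W`. -/
instance : SemilatticeSup MonoidVariety.{u} where
  sup V W := generatedBy fun M _ => V.Mem M ∨ W.Mem M
  le_sup_left _ _ M _ h _ hX := hX M (Or.inl h)
  le_sup_right _ _ M _ h _ hX := hX M (Or.inr h)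
  sup_le _ _ X h₁ h₂ _ _ h := h X fun N _ hN => hN.elim (h₁ N) (h₂ N)

/-- The variety generated by a single monoid `S` (which may live in the lowest universe). -/
def generatedByMonoid (S : Type) [Monoid S] : MonoidVariety.{u} :=
  generatedBy fun M _ => Nonempty (M ≃* S)

/-- `var Σ`: the variety of all monoids satisfying every identity in `Σ`. -/
def ofIdentities (E : Set Identity) : MonoidVariety.{u} where
  Mem M _ := ∀ e ∈ E, Satisfies M e
  image_mem {M N} _ _ f hf h e he φ := by
    choose g hg using fun i : ℕ => hf (φ (FreeMonoid.of i))
    have hφ : f.comp (FreeMonoid.lift g) = φ := by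
      ext i
      simp [hg]
    rw [← hφ]
    exact congrArg f (h e he (FreeMonoid.lift g))
  sub_mem f hf h e he φ := hf (h e he (f.comp φ))
  pi_mem M _ h e he φ := by
    funext i
    exact h i e he ((Pi.evalMonoidHom M i).comp φ)

/-- A variety is finitely based if it is defined by some finite set of identities. -/
def IsFinitelyBased (V : MonoidVariety.{u}) : Prop :=
  ∃ E : Set Identity, E.Finite ∧ V = ofIdentities E

end MonoidVariety

/-! ### The semigroup `A` -/

/-- The elements of the semigroup
`A = ⟨a, b, c ∣ a² = a, b² = b, ab = ca = 0, ac = cb = c⟩ = {a, b, c, ba, bc, 0}`. -/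
inductive SemigroupA : Type
  | a | b | c | ba | bc | zero
  deriving DecidableEq

namespace SemigroupA

/-- The multiplication table of `A`; all products not listed are `0`. -/
def mul : SemigroupA → SemigroupA → SemigroupA
  | a, a => a
  | a, c => c
  | b, a => ba
  | b, b => b
  | b, c => bc
  | b, ba => ba
  | b, bc => bc
  | c, b => c
  | ba, a => ba
  | ba, c => bc
  | bc, b => bc
  | _, _ => zero

instance : Semigroup SemigroupA where
  mul := mul
  mul_assoc := by rintro ⟨⟩ ⟨⟩ ⟨⟩ <;> rfl

end SemigroupA

/-! ### The semigroup `E` -/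

/-- The elements of the semigroup
`E = ⟨a, b, c ∣ a² = ab = 0, ba = ca = a, b² = bc = b, c² = cb = c⟩ = {a, b, c, ac, 0}`. -/
inductive SemigroupE : Type
  | a | b | c | ac | zero
  deriving DecidableEq

namespace SemigroupE

/-- The multiplication table of `E`; all products not listed are `0`. -/
def mul : SemigroupE → SemigroupE → SemigroupE
  | a, c => ac
  | b, a => a
  | b, b => b
  | b, c => b
  | b, ac => ac
  | c, a => a
  | c, b => c
  | c, c => c
  | c, ac => ac
  | ac, b => ac
  | ac, c => ac
  | _, _ => zero

instance : Semigroup SemigroupE where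
  mul := mul
  mul_assoc := by rintro ⟨⟩ ⟨⟩ ⟨⟩ <;> rfl

end SemigroupE

/-! ### The varieties in question

For a semigroup `S`, the monoid `S¹` obtained by adjoining a new identity element is `WithOne S`. -/

/-- `𝔸¹`, the variety generated by the monoid `A¹`. -/
def varA1 : MonoidVariety.{u} := MonoidVariety.generatedByMonoid (WithOne SemigroupA)

/-- `𝔼¹`, the variety generated by the monoid `E¹`. -/
def varE1 : MonoidVariety.{u} := MonoidVariety.generatedByMonoid (WithOne SemigroupE)

/-- The letter `t_k` (for `k ≥ 1`); the letters `a` and `b` below have indices `0` and `1`. -/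
def tLetter (k : ℕ) : Word := letter (k + 1)

/-- `u₀ = a²b²`, and `u_{k+1} = a t_{k+1} u_k` for even `k`, `u_{k+1} = b t_{k+1} u_k` for odd
`k`. -/
def uWord : ℕ → Word
  | 0 => letter 0 ^ 2 * letter 1 ^ 2
  | k + 1 => (if Even k then letter 0 else letter 1) * tLetter (k + 1) * uWord k

/-- `v₀ = b²a²`, and `v_{k+1} = a t_{k+1} v_k` for even `k`, `v_{k+1} = b t_{k+1} v_k` for odd
`k`. -/
def vWord : ℕ → Word
  | 0 => letter 1 ^ 2 * letter 0 ^ 2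
  | k + 1 => (if Even k then letter 0 else letter 1) * tLetter (k + 1) * vWord k

/-- The defining identities of `𝔼¹{σ_n}`:
`xtx ≈ xtx² ≈ x²tx`, `xy²x ≈ x²y²` and `u_n ≈ v_n`. -/
def identitiesESigma (n : ℕ) : Set Identity :=
  let x := letter 0
  let y := letter 1
  let t := letter 2
  {(x * t * x, x * t * x ^ 2), (x * t * x ^ 2, x ^ 2 * t * x),
    (x * y ^ 2 * x, x ^ 2 * y ^ 2), (uWord n, vWord n)}

/-- The variety `𝔼¹{σ_n}`. -/
def varE1Sigma (n : ℕ) : MonoidVariety.{u} := MonoidVariety.ofIdentities (identitiesESigma n)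

end MonVar

/-!
Call a word over `ℕ` *unsplit* if its letters `1, …, n` all occur and are in nondecreasing order,
and every `0` that comes after a `1` also comes after an `n`. The syntactic monoid of this language
satisfies all short identities `s ≈ t` of `𝔸¹ ∨ 𝔼¹{σ₂}`, but not
`0 1² 2² ⋯ n² 0 ≈ 0 1² 0 2² ⋯ n² 0`, which holds in `𝔸¹ ∨ 𝔼¹`; so no finite set of identities
suffices.

If a substitution turns an `s` with fewer than `n` letters into an unsplit word, then the value of
some letter `p` of `s` contains two of `1, …, n`. Since these are in order, `p` occurs only once, no
`n` comes from a letter before `p`, and no `1` from a letter after `p`. The identities of `A¹` keep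
`p` linear and preserve which pairs of letters occur in a given order, also inside the part before
`p` if the first letter of the pair does not occur after `p`. Those of `𝔼¹{σ₂}` preserve the order
of first occurrences after `p` of a letter absent before `p` and any other letter. Together they
ensure that in `t`, too, a letter whose value contains a `0` comes after one whose value contains an
`n` if it comes after one whose value contains a `1`. The context of a substitution is treated as
two more letters of `s` and `t`.
-/

namespace MonVar

section Identities

variable {α β M N : Type*} [Monoid M] [Monoid N]

/-- The identity `s ≈ t` holds in `M`, for words over an arbitrary alphabet, given as lists of
letters. -/
def Holds (M : Type*) [Monoid M] (s t : List α) : Prop :=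
  ∀ f : α → M, (s.map f).prod = (t.map f).prod

theorem satisfies_iff_holds {e : Identity} :
    Satisfies M e ↔ Holds M e.1.toList e.2.toList := by
  simp only [Satisfies, Holds, FreeMonoid.lift.surjective.forall, FreeMonoid.lift_apply]

theorem satisfies_congr (i : M ≃* N) {e : Identity} : Satisfies M e ↔ Satisfies N e :=
  ⟨fun h φ => i.symm.injective (h (i.symm.toMonoidHom.comp φ)),
    fun h φ => i.injective (h (i.toMonoidHom.comp φ))⟩

theorem prod_map_flatMap (g : β → M) (f : α → List β) (s : List α) :
    ((s.flatMap f).map g).prod = (s.map fun i => ((f i).map g).prod).prod := by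
  simp [List.flatMap_def, List.map_flatten, List.prod_flatten, Function.comp_def]

variable {s t : List α}

theorem Holds.refl (s : List α) : Holds M s s := fun _ => rfl

theorem Holds.symm (h : Holds M s t) : Holds M t s := fun f => (h f).symm

theorem Holds.append {s' t' : List α} (h : Holds M s t) (h' : Holds M s' t') :
    Holds M (s ++ s') (t ++ t') := fun f => by
  simp only [List.map_append, List.prod_append, h f, h' f]

theorem Holds.flatMap (h : Holds M s t) (f : α → List β) :
    Holds M (s.flatMap f) (t.flatMap f) := fun g => by
  simp only [prod_map_flatMap, h _]

theorem Holds.prod_mul_prod_eq_of_linear {s₁ s₂ t₁ t₂ : List α} {p : α}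
    (h : Holds M (s₁ ++ p :: s₂) (t₁ ++ p :: t₂))
    (hs₁ : p ∉ s₁) (hs₂ : p ∉ s₂) (ht₁ : p ∉ t₁) (ht₂ : p ∉ t₂) (f : α → M) (x : M) :
    (s₁.map f).prod * (x * (s₂.map f).prod) = (t₁.map f).prod * (x * (t₂.map f).prod) := by
  classical
  have map_update {w : List α} (hw : p ∉ w) : w.map (Function.update f p x) = w.map f :=
    List.map_congr_left fun i hi => Function.update_of_ne (ne_of_mem_of_not_mem hi hw) x f
  simpa [map_update, *] using h (Function.update f p x)

theorem mul_prod_eq_self {x : M} {l : List M} (h : ∀ g ∈ l, x * g = x) : x * l.prod = x := by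
  induction l with
  | nil => simp
  | cons g l ih =>
    rw [List.forall_mem_cons] at h
    rw [List.prod_cons, ← mul_assoc, h.1, ih h.2]

theorem prod_mul_eq_self {x : M} {l : List M} (h : ∀ g ∈ l, g * x = x) : l.prod * x = x := by
  induction l with
  | nil => simp
  | cons g l ih =>
    rw [List.forall_mem_cons] at h
    rw [List.prod_cons, mul_assoc, ih h.2, h.1]

theorem prod_map_ite_eq_pow [DecidableEq α] (p : α) (x : M) (s : List α) :
    (s.map fun i => if i = p then x else 1).prod = x ^ s.count p := by
  induction s with
  | nil => simp
  | cons i s ih => by_cases hi : i = p <;> simp [hi, ih, pow_succ']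

end Identities

section SyntacticMonoid

/-- The syntactic congruence of a subset `Q` of a monoid: `u` and `v` are related if they have the
same contexts with respect to `Q`. -/
def syntacticCon {M : Type*} [Monoid M] (Q : Set M) : Con M where
  r u v := ∀ l r, l * u * r ∈ Q ↔ l * v * r ∈ Q
  iseqv := ⟨fun _ _ _ => Iff.rfl, fun h l r => (h l r).symm,
    fun h h' l r => (h l r).trans (h' l r)⟩
  mul' {u v u' v'} h h' l r := by
    simpa only [mul_assoc] using (h l (u' * r)).trans (by simpa only [mul_assoc] using h' (l * v) r)

theorem satisfies_quotient_iff {c : Con Word} {e : Identity} :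
    Satisfies c.Quotient e ↔ ∀ ψ : Word →* Word, c (ψ e.1) (ψ e.2) := by
  constructor
  · intro h ψ
    exact (Con.eq c).1 (h (c.mk'.comp ψ))
  · intro h φ
    choose g hg using fun i => c.mk'_surjective (φ (FreeMonoid.of i))
    have hφ : c.mk'.comp (FreeMonoid.lift g) = φ := FreeMonoid.hom_eq fun i => hg i
    rw [← hφ]
    exact (Con.eq c).2 (h (FreeMonoid.lift g))

theorem toList_hom_apply (ψ : Word →* Word) (u : Word) :
    (ψ u).toList = u.toList.flatMap fun i => (ψ (FreeMonoid.of i)).toList := by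
  induction u using FreeMonoid.inductionOn' with
  | one => simp
  | of_mul i u ih => simp [ih]

end SyntacticMonoid

section SemigroupA

variable {α : Type*}

instance : Fintype SemigroupA :=
  ⟨{.a, .b, .c, .ba, .bc, .zero}, by rintro ⟨⟩ <;> decide⟩

instance : Fintype SemigroupE :=
  ⟨{.a, .b, .c, .ac, .zero}, by rintro ⟨⟩ <;> decide⟩

instance {S : Type*} [DecidableEq S] : DecidableEq (WithOne S) :=
  inferInstanceAs (DecidableEq (Option S))

instance {S : Type*} [Fintype S] : Fintype (WithOne S) :=
  inferInstanceAs (Fintype (Option S))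

namespace SemigroupA

theorem c_pow (k : ℕ) :
    (c : WithOne SemigroupA) ^ k = if k = 0 then 1 else if k = 1 then ↑c else ↑zero := by
  match k with
  | 0 => simp
  | 1 => simp
  | k + 2 =>
    have mul_zero : ∀ u : WithOne SemigroupA, u * zero = zero := by decide
    rw [pow_add, show (c : WithOne SemigroupA) ^ 2 = zero from rfl, mul_zero]
    simp

/-- The substitution `y ↦ a`, `z ↦ b`, all other letters to the identity. -/
def abEval [DecidableEq α] (y z i : α) : WithOne SemigroupA :=
  if i = y then ↑a else if i = z then ↑b else 1

open Classical in
theorem prod_abEval_mul_c {y z : α} (hyz : y ≠ z) (s : List α) :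
    (s.map (abEval y z)).prod * c =
      if [y, z].Sublist s then ↑zero else if z ∈ s then ↑bc else ↑c := by
  induction s with
  | nil => simp
  | cons i s ih =>
    have hz_mem : [y, z].Sublist s → z ∈ s := fun h => h.subset (by simp)
    rw [List.map_cons, List.prod_cons, mul_assoc, ih]
    by_cases hy : i = y
    · subst hy
      simp only [abEval, if_true, List.cons_sublist_cons, List.singleton_sublist, List.mem_cons,
        hyz.symm, false_or]
      split_ifs <;> first | rfl | tauto
    · by_cases hz : i = z
      · subst hz
        simp only [abEval, hy, if_true, if_false, List.cons_sublist_cons', Ne.symm hy, false_and,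
          or_false, List.mem_cons, true_or]
        split_ifs <;> rfl
      · simp only [abEval, hy, hz, if_false, one_mul, List.cons_sublist_cons', Ne.symm hy,
          false_and, or_false, List.mem_cons, Ne.symm hz, false_or]

end SemigroupA

variable {s t : List α}

theorem Holds.min_count_two [DecidableEq α] (h : Holds (WithOne SemigroupA) s t) (p : α) :
    min (s.count p) 2 = min (t.count p) 2 := by
  have hc := h fun i => if i = p then ↑SemigroupA.c else 1
  rw [prod_map_ite_eq_pow, prod_map_ite_eq_pow, SemigroupA.c_pow, SemigroupA.c_pow] at hc
  split_ifs at hc <;> first | omega | cases hc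

theorem Holds.mem_iff (h : Holds (WithOne SemigroupA) s t) (p : α) : p ∈ s ↔ p ∈ t := by
  classical
  have := h.min_count_two p
  rw [← List.count_pos_iff, ← List.count_pos_iff]
  omega

theorem Holds.pair_sublist_iff (h : Holds (WithOne SemigroupA) s t) (y z : α) :
    [y, z].Sublist s ↔ [y, z].Sublist t := by
  classical
  rcases eq_or_ne y z with rfl | hyz
  · have := h.min_count_two y
    rw [show [y, y] = List.replicate 2 y from rfl, List.replicate_sublist_iff,
      List.replicate_sublist_iff]
    omega
  · have hc := congrArg (· * (SemigroupA.c : WithOne SemigroupA)) (h (SemigroupA.abEval y z))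
    simp only [SemigroupA.prod_abEval_mul_c hyz] at hc
    split_ifs at hc <;> tauto

theorem Holds.exists_eq_append_linear {s₁ s₂ : List α} {p : α}
    (h : Holds (WithOne SemigroupA) (s₁ ++ p :: s₂) t) (hs₁ : p ∉ s₁) (hs₂ : p ∉ s₂) :
    ∃ t₁ t₂, t = t₁ ++ p :: t₂ ∧ p ∉ t₁ ∧ p ∉ t₂ := by
  classical
  obtain ⟨t₁, t₂, rfl⟩ := List.append_of_mem ((h.mem_iff p).1 (by simp))
  have := h.min_count_two p
  simp only [List.count_append, List.count_cons_self, List.count_eq_zero.2 hs₁,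
    List.count_eq_zero.2 hs₂] at this
  exact ⟨t₁, t₂, rfl, List.count_eq_zero.1 (by omega), List.count_eq_zero.1 (by omega)⟩

theorem Holds.pair_sublist_of_notMem_after_linear {s₁ s₂ t₁ t₂ : List α} {p y z : α}
    (h : Holds (WithOne SemigroupA) (s₁ ++ p :: s₂) (t₁ ++ p :: t₂))
    (hs₁ : p ∉ s₁) (hs₂ : p ∉ s₂) (ht₁ : p ∉ t₁) (ht₂ : p ∉ t₂) (hy : y ∉ s₂)
    (ht : [y, z].Sublist t₁) : [y, z].Sublist s₁ := by
  classical
  have hyp : y ≠ p := ne_of_mem_of_not_mem (ht.subset (by simp)) ht₁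
  rcases eq_or_ne y z with rfl | hyz
  · have hcount := h.min_count_two y
    rw [show [y, y] = List.replicate 2 y from rfl, List.replicate_sublist_iff] at ht ⊢
    simp only [List.count_append, List.count_cons_of_ne hyp.symm, List.count_eq_zero.2 hy] at hcount
    omega
  · have hc := h.prod_mul_prod_eq_of_linear hs₁ hs₂ ht₁ ht₂ (SemigroupA.abEval y z) SemigroupA.c
    have hs₂c : (SemigroupA.c : WithOne SemigroupA) * (s₂.map (SemigroupA.abEval y z)).prod =
        SemigroupA.c := by
      refine mul_prod_eq_self (List.forall_mem_map.2 fun i hi => ?_)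
      simp only [SemigroupA.abEval, ne_of_mem_of_not_mem hi hy, if_false]
      split_ifs <;> rfl
    have zero_mul : ∀ u : WithOne SemigroupA, SemigroupA.zero * u = SemigroupA.zero := by decide
    rw [hs₂c, ← mul_assoc, SemigroupA.prod_abEval_mul_c hyz, SemigroupA.prod_abEval_mul_c hyz,
      if_pos ht, zero_mul] at hc
    split_ifs at hc <;> first | assumption | cases hc

end SemigroupA

section TransitionMonoid

/-- The transition monoid of the automaton with states `0, 1, 2` and partial transitions
`z : 0 ↦ 0, 2 ↦ 2`, `y : 1 ↦ 2, 2 ↦ 2` and `p : 0 ↦ 1`, acting on the right. It lies in `𝔼¹{σ₂}`,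
and detects whether `y` comes before `z` in the part of a word that follows `p`. -/
inductive TransitionMonoid : Type
  | one | z | y | p | py | zy | zero
  deriving DecidableEq

namespace TransitionMonoid

instance : Fintype TransitionMonoid :=
  ⟨{.one, .z, .y, .p, .py, .zy, .zero}, by rintro ⟨⟩ <;> decide⟩

/-- The multiplication table of `TransitionMonoid`; all products not listed are `0`. -/
def mul : TransitionMonoid → TransitionMonoid → TransitionMonoid
  | one, u => u
  | u, one => u
  | z, z => z
  | z, y => zy
  | z, p => p
  | z, py => py
  | z, zy => zy
  | y, z => y
  | y, y => y
  | y, zy => y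
  | p, y => py
  | py, z => py
  | py, y => py
  | py, zy => py
  | zy, z => zy
  | zy, y => zy
  | zy, zy => zy
  | _, _ => zero

instance : Monoid TransitionMonoid where
  mul := mul
  one := one
  mul_assoc := by rintro ⟨⟩ ⟨⟩ ⟨⟩ <;> rfl
  one_mul := by rintro ⟨⟩ <;> rfl
  mul_one := by rintro ⟨⟩ <;> rfl

theorem mem_varE1Sigma : (varE1Sigma.{u} 2).Mem (ULift.{u} TransitionMonoid) := by
  intro e he
  rw [satisfies_congr MulEquiv.ulift]
  have hxtx : ∀ x t : TransitionMonoid,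
      x * t * x = x * t * x ^ 2 ∧ x * t * x ^ 2 = x ^ 2 * t * x := by
    decide
  have hxyyx : ∀ u v : TransitionMonoid, u * v ^ 2 * u = u ^ 2 * v ^ 2 := by decide
  have hσ : ∀ a b : TransitionMonoid, a ^ 2 * b ^ 2 = b ^ 2 * a ^ 2 ∨
      ∀ t₁, a * t₁ * (a ^ 2 * b ^ 2) = a * t₁ * (b ^ 2 * a ^ 2) ∨
      ∀ t₂, b * t₂ * (a * t₁ * (a ^ 2 * b ^ 2)) = b * t₂ * (a * t₁ * (b ^ 2 * a ^ 2)) := by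
    decide
  rcases he with rfl | rfl | rfl | rfl <;> intro φ
  · simpa using (hxtx _ _).1
  · simpa using (hxtx _ _).2
  · simpa using hxyyx _ _
  · simp only [uWord, vWord, map_mul, map_pow]
    rcases hσ (φ (letter 0)) (φ (letter 1)) with h | h
    · simp [h]
    · rcases h (φ (tLetter 1)) with h | h
      · simp [h]
      · simpa using h (φ (tLetter 2))

variable {α : Type*} [DecidableEq α]

/-- The substitution of the generators `y` and `z` for the letters `i` and `j`, and of the identity
for all other letters. -/
def yzEval (i j k : α) : TransitionMonoid :=
  if k = i then y else if k = j then z else 1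

theorem y_mul_prod_yzEval (i j : α) (s : List α) : y * (s.map (yzEval i j)).prod = y := by
  refine mul_prod_eq_self (List.forall_mem_map.2 fun k _ => ?_)
  unfold yzEval
  split_ifs <;> rfl

theorem prod_yzEval_eq_y_iff {i j : α} (hij : i ≠ j) (s : List α) :
    (s.map (yzEval i j)).prod = y ↔ s.idxOf i < s.idxOf j := by
  induction s with
  | nil => exact iff_of_false (show (1 : TransitionMonoid) ≠ y by decide) (by simp)
  | cons k s ih =>
    rw [List.map_cons, List.prod_cons]
    by_cases hi : k = i
    · subst hi
      simp [yzEval, y_mul_prod_yzEval, List.idxOf_cons_ne _ hij]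
    · by_cases hj : k = j
      · subst hj
        have hz : ∀ u : TransitionMonoid, z * u ≠ y := by decide
        simp [yzEval, hi, hz]
      · rw [List.idxOf_cons_ne _ hi, List.idxOf_cons_ne _ hj, Nat.succ_lt_succ_iff, ← ih]
        simp [yzEval, hi, hj]

theorem prod_yzEval_mul_p {i j : α} {s : List α} (hi : i ∉ s) :
    (s.map (yzEval i j)).prod * p = p := by
  refine prod_mul_eq_self (List.forall_mem_map.2 fun k hk => ?_)
  simp only [yzEval, ne_of_mem_of_not_mem hk hi, if_false]
  split_ifs <;> rfl

theorem eq_y_of_p_mul_y_eq : ∀ {u v : TransitionMonoid}, p * y = u * (p * v) → v = y := by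
  decide

end TransitionMonoid

variable {α : Type*} [DecidableEq α]

theorem Holds.idxOf_lt_idxOf_after_linear {s₁ s₂ t₁ t₂ : List α} {p y z : α}
    (h : Holds TransitionMonoid (s₁ ++ p :: s₂) (t₁ ++ p :: t₂))
    (hs₁ : p ∉ s₁) (hs₂ : p ∉ s₂) (ht₁ : p ∉ t₁) (ht₂ : p ∉ t₂) (hyz : y ≠ z) (hy : y ∉ s₁)
    (hs : s₂.idxOf y < s₂.idxOf z) : t₂.idxOf y < t₂.idxOf z := by
  have hp := h.prod_mul_prod_eq_of_linear hs₁ hs₂ ht₁ ht₂ (TransitionMonoid.yzEval y z) .p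
  rw [← TransitionMonoid.prod_yzEval_eq_y_iff hyz] at hs ⊢
  rw [← mul_assoc, TransitionMonoid.prod_yzEval_mul_p hy, hs] at hp
  exact TransitionMonoid.eq_y_of_p_mul_y_eq hp

end TransitionMonoid

section Guarded

variable {α β : Type*}

theorem exists_of_append_eq_append_cons {z : α} {a b l r : List α} (h : a ++ b = l ++ z :: r) :
    (∃ r', a = l ++ z :: r') ∨ ∃ l', l = a ++ l' ∧ b = l' ++ z :: r := by
  rcases List.append_eq_append_iff.1 h with ⟨l', rfl, hb⟩ | ⟨r', rfl, hr⟩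
  · exact .inr ⟨l', rfl, hb⟩
  · cases r' with
    | nil => exact .inr ⟨[], by simp, by simpa using hr.symm⟩
    | cons x r' =>
      obtain ⟨rfl, -⟩ := List.cons.inj hr
      exact .inl ⟨r', rfl⟩

theorem exists_of_flatMap_eq_append_cons {f : α → List β} {x : β} {t : List α} {l r : List β}
    (h : t.flatMap f = l ++ x :: r) :
    ∃ t₁ z t₂ a b, t = t₁ ++ z :: t₂ ∧ f z = a ++ x :: b ∧ l = t₁.flatMap f ++ a := by
  induction t generalizing l with
  | nil => simp at h
  | cons i t ih =>
    rw [List.flatMap_cons] at h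
    rcases exists_of_append_eq_append_cons h with ⟨b, hb⟩ | ⟨l', rfl, hl'⟩
    · exact ⟨[], i, t, l, b, rfl, hb, rfl⟩
    · obtain ⟨t₁, z, t₂, a, b, rfl, hz, rfl⟩ := ih hl'
      exact ⟨i :: t₁, z, t₂, a, b, rfl, hz, by simp⟩

theorem pair_sublist_append {y z : α} {l r : List α} (hy : y ∈ l) (hz : z ∈ r) :
    [y, z].Sublist (l ++ r) :=
  (List.singleton_sublist.2 hy).append (List.singleton_sublist.2 hz)

theorem exists_split_of_pair_sublist {y z : α} {l : List α} (h : [y, z].Sublist l) :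
    ∃ l₁ l₂, l = l₁ ++ z :: l₂ ∧ y ∈ l₁ := by
  obtain ⟨l₁, l₂, rfl, hy, hz⟩ := List.cons_sublist_iff.1 h
  obtain ⟨a, b, rfl⟩ := List.append_of_mem (List.singleton_sublist.1 hz)
  exact ⟨l₁ ++ a, b, by simp, by simp [hy]⟩

theorem mem_of_pair_sublist_append_cons {p z : α} {l r : List α} (hp : p ∉ l)
    (h : [p, z].Sublist (l ++ p :: r)) : z ∈ r := by
  induction l with
  | nil => simpa using h
  | cons i l ih =>
    rw [List.mem_cons, not_or] at hp
    exact ih hp.2 (h.of_cons_of_ne hp.1)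

theorem idxOf_lt_idxOf_of_mem_of_notMem [DecidableEq α] {y z : α} {l r : List α} (hy : y ∈ l)
    (hz : z ∉ l) : (l ++ r).idxOf y < (l ++ r).idxOf z := by
  rw [List.idxOf_append_of_mem hy, List.idxOf_append_of_notMem hz]
  exact (List.idxOf_lt_length_of_mem hy).trans_le (Nat.le_add_right _ _)

theorem mem_of_idxOf_lt_idxOf [DecidableEq α] {y z : α} {l r : List α}
    (h : (l ++ z :: r).idxOf y < (l ++ z :: r).idxOf z) : y ∈ l := by
  by_contra hy
  by_cases hz : z ∈ l
  · exact (idxOf_lt_idxOf_of_mem_of_notMem hz hy).asymm h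
  · simp [List.idxOf_append_of_notMem, hy, hz] at h

/-- Every occurrence of `z` in `w` that comes after a letter from `P` also comes after a letter
from `N`. -/
def Guarded (P N : Set α) (z : α) (w : List α) : Prop :=
  ∀ ⦃l r⦄, w = l ++ z :: r → (∃ y ∈ l, y ∈ P) → ∃ y ∈ l, y ∈ N

variable {P N : Set α} {p z : α} {s t s₁ s₂ t₁ t₂ : List α}

theorem Guarded.exists_mem_of_mem_after_linear
    (hA : Holds (WithOne SemigroupA) (s₁ ++ p :: s₂) (t₁ ++ p :: t₂))
    (hT : Holds TransitionMonoid (s₁ ++ p :: s₂) (t₁ ++ p :: t₂))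
    (hs₁ : p ∉ s₁) (hs₂ : p ∉ s₂) (ht₁ : p ∉ t₁) (ht₂ : p ∉ t₂)
    (hP : ∃ y ∈ s₁ ++ [p], y ∈ P) (hN : ∀ y ∈ s₁, y ∉ N)
    (hG : Guarded P N z (s₁ ++ p :: s₂)) {l r : List α} (hl : t₂ = l ++ z :: r) :
    ∃ y ∈ p :: l, y ∈ N := by
  classical
  have hz : z ∈ s₂ :=
    mem_of_pair_sublist_append_cons hs₁ ((hA.pair_sublist_iff p z).2 (by simp [hl]))
  obtain ⟨l', r', rfl, hzl'⟩ := List.eq_append_cons_of_mem hz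
  obtain ⟨y, hy, hyN⟩ : ∃ y ∈ s₁ ++ p :: l', y ∈ N := by
    obtain ⟨y, hy, hyP⟩ := hP
    refine hG (r := r') (by simp) ⟨y, ?_, hyP⟩
    rw [List.mem_append, List.mem_singleton] at hy
    rw [List.mem_append, List.mem_cons]
    tauto
  have hys₁ : y ∉ s₁ := fun h => hN y h hyN
  rcases List.mem_cons.1 ((List.mem_append.1 hy).resolve_left hys₁) with rfl | hyl'
  · exact ⟨y, by simp, hyN⟩
  · have hyz : y ≠ z := ne_of_mem_of_not_mem hyl' hzl'
    have hlt := hT.idxOf_lt_idxOf_after_linear hs₁ hs₂ ht₁ ht₂ hyz hys₁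
      (idxOf_lt_idxOf_of_mem_of_notMem hyl' hzl')
    rw [hl] at hlt
    exact ⟨y, List.mem_cons_of_mem p (mem_of_idxOf_lt_idxOf hlt), hyN⟩

theorem Guarded.of_holds_of_linear (hA : Holds (WithOne SemigroupA) (s₁ ++ p :: s₂) t)
    (hT : Holds TransitionMonoid (s₁ ++ p :: s₂) t) (hs₁ : p ∉ s₁) (hs₂ : p ∉ s₂)
    (hN : ∀ y ∈ s₁, y ∉ N) (hP : ∀ y ∈ s₂, y ∉ P)
    (hG : Guarded P N z (s₁ ++ p :: s₂)) : Guarded P N z t := by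
  obtain ⟨t₁, t₂, rfl, ht₁, ht₂⟩ := hA.exists_eq_append_linear hs₁ hs₂
  rintro l r hl ⟨y, hyl, hyP⟩
  have hys₂ : y ∉ s₂ := fun h => hP y h hyP
  have hy : y ∈ s₁ ++ [p] := by
    have : y ∈ s₁ ++ p :: s₂ := (hA.mem_iff y).2 (by simp [hl, hyl])
    simpa [hys₂] using this
  have not_split {l' r' : List α} (hs : s₁ = l' ++ z :: r') (hyl' : y ∈ l') : False := by
    obtain ⟨y', hy', hyN⟩ := hG (l := l') (r := r' ++ p :: s₂) (by simp [hs]) ⟨y, hyl', hyP⟩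
    exact hN y' (by simp [hs, hy']) hyN
  rcases exists_of_append_eq_append_cons hl with ⟨r', rfl⟩ | ⟨l', rfl, hl'⟩
  · have hyz : [y, z].Sublist s₁ := hA.pair_sublist_of_notMem_after_linear hs₁ hs₂ ht₁ ht₂ hys₂
      (pair_sublist_append hyl (by simp))
    obtain ⟨l', r', hs, hyl'⟩ := exists_split_of_pair_sublist hyz
    exact (not_split hs hyl').elim
  · cases l' with
    | nil =>
      obtain ⟨rfl, -⟩ := List.cons.inj hl'
      rw [List.append_nil] at hyl
      have hys₁ : y ∈ s₁ := by simpa [ne_of_mem_of_not_mem hyl ht₁] using hy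
      obtain ⟨y', hy', hyN⟩ := hG rfl ⟨y, hys₁, hyP⟩
      exact (hN y' hy' hyN).elim
    | cons i l' =>
      obtain ⟨rfl, ht₂'⟩ := List.cons.inj hl'
      obtain ⟨y', hy', hyN⟩ := hG.exists_mem_of_mem_after_linear hA hT hs₁ hs₂ ht₁ ht₂
        ⟨y, hy, hyP⟩ hN ht₂'
      exact ⟨y', List.mem_append_right t₁ hy', hyN⟩

end Guarded

section Unsplit

/-- The words in which each of the letters `1, …, n` occurs, the nonzero letters are in
nondecreasing order, and every `0` that comes after a `1` also comes after an `n`. -/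
structure Unsplit (n : ℕ) (w : List ℕ) : Prop where
  mem : ∀ k ∈ Finset.Icc 1 n, k ∈ w
  ordered : w.Pairwise fun i j => j = 0 ∨ i ≤ j
  guarded : Guarded {1} {n} 0 w

variable {α β : Type*} {n : ℕ}

theorem exists_lt_mem_mem_of_length_lt_card [LinearOrder β] {A : Finset β} {f : α → List β}
    {s : List α} (hs : s.length < A.card) (h : ∀ k ∈ A, k ∈ s.flatMap f) :
    ∃ p ∈ s, ∃ j ∈ A, ∃ k ∈ A, j < k ∧ j ∈ f p ∧ k ∈ f p := by
  classical
  obtain ⟨k, hk⟩ := Finset.card_pos.1 (Nat.zero_lt_of_lt hs)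
  obtain ⟨p, -, -⟩ := List.mem_flatMap.1 (h k hk)
  have : Nonempty α := ⟨p⟩
  choose! g hg using fun k hk => List.mem_flatMap.1 (h k hk)
  obtain ⟨j, hj, k, hk, hjk, hg_eq⟩ := Finset.exists_ne_map_eq_of_card_lt_of_maps_to
    (s.toFinset_card_le.trans_lt hs) fun k hk => List.mem_toFinset.2 (hg k hk).1
  rcases hjk.lt_or_gt with hlt | hlt
  · exact ⟨g j, (hg j hj).1, j, hj, k, hk, hlt, (hg j hj).2, hg_eq ▸ (hg k hk).2⟩
  · exact ⟨g j, (hg j hj).1, k, hk, j, hj, hlt, hg_eq ▸ (hg k hk).2, (hg j hj).2⟩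

variable {f : α → List ℕ} {s t : List α}

theorem Unsplit.exists_dividing_letter (hs : s.length < n) (hU : Unsplit n (s.flatMap f)) :
    ∃ s₁ p s₂, s = s₁ ++ p :: s₂ ∧ p ∉ s₁ ∧ p ∉ s₂ ∧ (∀ y ∈ s₁, n ∉ f y) ∧ ∀ y ∈ s₂, 1 ∉ f y := by
  obtain ⟨p, hp, j, hj, k, hk, hjk, hjp, hkp⟩ :=
    exists_lt_mem_mem_of_length_lt_card (A := Finset.Icc 1 n) (by simpa using hs) hU.mem
  rw [Finset.mem_Icc] at hj hk
  obtain ⟨s₁, s₂, rfl⟩ := List.append_of_mem hp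
  obtain ⟨-, h₂, h₁₂⟩ := List.pairwise_append.1 (List.pairwise_flatMap.1 hU.ordered).2
  have le_j {y i} (hy : y ∈ s₁) (hi : i ∈ f y) : i ≤ j :=
    (h₁₂ y hy p (by simp) i hi j hjp).resolve_left (by omega)
  have k_le {y i} (hy : y ∈ s₂) (hi : i ∈ f y) (hi0 : i ≠ 0) : k ≤ i :=
    ((List.pairwise_cons.1 h₂).1 y hy k hkp i hi).resolve_left hi0
  refine ⟨s₁, p, s₂, rfl, fun h => ?_, fun h => ?_, fun y hy h => ?_, fun y hy h => ?_⟩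
  · exact (le_j h hkp).not_gt hjk
  · exact (k_le h hjp (by omega)).not_gt hjk
  · have := le_j hy h
    omega
  · have := k_le hy h one_ne_zero
    omega

variable {z : α} {s₁ s₂ : List α} {a b : List ℕ}

theorem Unsplit.mem_flatMap_of_one_mem (hU : Unsplit n ((s₁ ++ z :: s₂).flatMap f))
    (hz : f z = a ++ 0 :: b) (hna : n ∉ a) (h : 1 ∈ s₁.flatMap f ++ a) : n ∈ s₁.flatMap f := by
  obtain ⟨_, hn, rfl⟩ := hU.guarded (l := s₁.flatMap f ++ a) (r := b ++ s₂.flatMap f)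
    (by simp [hz]) ⟨1, h, rfl⟩
  exact (List.mem_append.1 hn).resolve_right hna

theorem Unsplit.one_notMem_before_zero (hn : 1 < n) (hU : Unsplit n ((s₁ ++ z :: s₂).flatMap f))
    (hz : f z = a ++ 0 :: b) (hna : n ∉ a) : 1 ∉ a := by
  intro h1a
  have hns₁ := hU.mem_flatMap_of_one_mem hz hna (List.mem_append_right _ h1a)
  have hn1 : [n, 1].Sublist ((s₁ ++ z :: s₂).flatMap f) := by
    rw [List.flatMap_append, List.flatMap_cons, hz]
    exact pair_sublist_append hns₁ (by simp [h1a])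
  have := List.pairwise_iff_forall_sublist.1 hU.ordered hn1
  omega

theorem Unsplit.guarded_letter (hU : Unsplit n (s.flatMap f)) (hz : f z = a ++ 0 :: b)
    (hna : n ∉ a) : Guarded {y | 1 ∈ f y} {y | n ∈ f y} z s := by
  rintro s₁ s₂ rfl h1
  exact List.mem_flatMap.1
    (hU.mem_flatMap_of_one_mem hz hna (List.mem_append_left _ (List.mem_flatMap.2 h1)))

theorem Unsplit.flatMap_of_holds (hA : Holds (WithOne SemigroupA) s t)
    (hT : Holds TransitionMonoid s t) (hs : s.length < n) (hU : Unsplit n (s.flatMap f)) :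
    Unsplit n (t.flatMap f) where
  mem k hk := ((hA.flatMap f).mem_iff k).1 (hU.mem k hk)
  ordered := List.pairwise_iff_forall_sublist.2 fun h =>
    List.pairwise_iff_forall_sublist.1 hU.ordered (((hA.flatMap f).pair_sublist_iff _ _).2 h)
  guarded := by
    rintro l r hl ⟨_, h1, rfl⟩
    obtain ⟨t₁, z, t₂, a, b, rfl, hz, rfl⟩ := exists_of_flatMap_eq_append_cons hl
    by_cases hna : n ∈ a
    · exact ⟨n, List.mem_append_right _ hna, rfl⟩
    have hzs : z ∈ s := (hA.mem_iff z).2 (by simp)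
    have h1a : 1 ∉ a := by
      have hn : 1 < n := (Nat.succ_le_of_lt (List.length_pos_of_mem hzs)).trans_lt hs
      obtain ⟨s₁, s₂, rfl⟩ := List.append_of_mem hzs
      exact hU.one_notMem_before_zero hn hz hna
    have hG := hU.guarded_letter hz hna
    obtain ⟨s₁, p, s₂, rfl, hs₁, hs₂, hN, hP⟩ := hU.exists_dividing_letter hs
    obtain ⟨y, hy, hyn⟩ := hG.of_holds_of_linear hA hT hs₁ hs₂ hN hP rfl
      (List.mem_flatMap.1 ((List.mem_append.1 h1).resolve_right h1a))
    exact ⟨n, List.mem_append_left _ (List.mem_flatMap.2 ⟨y, hy, hyn⟩), rfl⟩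

/-- The word `s` between two new letters, which stand for the context of a substitution. -/
def bracket (s : List α) : List (α ⊕ Bool) :=
  [.inr false] ++ s.flatMap (fun i => [.inl i]) ++ [.inr true]

theorem length_bracket (s : List α) : (bracket s).length = s.length + 2 := by
  simp [bracket]

theorem Holds.bracket {M : Type*} [Monoid M] (h : Holds M s t) :
    Holds M (bracket s) (bracket t) :=
  ((Holds.refl _).append (h.flatMap _)).append (Holds.refl _)

theorem flatMap_bracket (f : α → List β) (l r : List β) (s : List α) :
    (bracket s).flatMap (Sum.elim f fun i => if i then r else l) = l ++ s.flatMap f ++ r := by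
  simp [bracket, List.flatMap_assoc]

theorem Unsplit.of_holds_in_context (hA : Holds (WithOne SemigroupA) s t)
    (hT : Holds TransitionMonoid s t) (hs : s.length + 2 < n) {l r : List ℕ}
    (hU : Unsplit n (l ++ s.flatMap f ++ r)) :
    Unsplit n (l ++ t.flatMap f ++ r) := by
  rw [← flatMap_bracket] at hU ⊢
  exact hU.flatMap_of_holds hA.bracket hT.bracket ((length_bracket s).trans_lt hs)

/-- The syntactic monoid of the language of `Unsplit n` words. -/
abbrev UnsplitMonoid (n : ℕ) : Type :=
  (syntacticCon {w : Word | Unsplit n w.toList}).Quotient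

theorem satisfies_unsplitMonoid {e : Identity} (hA : Satisfies (WithOne SemigroupA) e)
    (hT : Satisfies TransitionMonoid e) (h₁ : e.1.toList.length + 2 < n)
    (h₂ : e.2.toList.length + 2 < n) : Satisfies (UnsplitMonoid n) e := by
  rw [satisfies_iff_holds] at hA hT
  refine satisfies_quotient_iff.2 fun ψ l r => ?_
  change Unsplit n (l.toList ++ (ψ e.1).toList ++ r.toList) ↔
    Unsplit n (l.toList ++ (ψ e.2).toList ++ r.toList)
  rw [toList_hom_apply ψ e.1, toList_hom_apply ψ e.2]
  exact ⟨.of_holds_in_context hA hT h₁, .of_holds_in_context hA.symm hT.symm h₂⟩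

end Unsplit

section SeparatingIdentities

/-- The product `k² (k + 1)² ⋯ (k + m - 1)²` of squares of letters. -/
def squares (k m : ℕ) : List ℕ :=
  (List.range' k m).flatMap fun i => [i, i]

/-- The word `0 1² 2² ⋯ (n + 1)² 0`. -/
def unsplitWord (n : ℕ) : List ℕ :=
  0 :: 1 :: 1 :: (squares 2 n ++ [0])

/-- The word `0 1² 0 2² ⋯ (n + 1)² 0`. -/
def splitWord (n : ℕ) : List ℕ :=
  0 :: 1 :: 1 :: 0 :: (squares 2 n ++ [0])

/-- The identity `0 1² 2² ⋯ (n + 1)² 0 ≈ 0 1² 0 2² ⋯ (n + 1)² 0`, which holds in `𝔸¹ ∨ 𝔼¹` but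
fails in `UnsplitMonoid (n + 1)`. -/
def separatingIdentity (n : ℕ) : Identity :=
  (FreeMonoid.ofList (unsplitWord n), FreeMonoid.ofList (splitWord n))

theorem mem_squares {i k m : ℕ} : i ∈ squares k m ↔ k ≤ i ∧ i < k + m := by
  simp [squares, List.mem_range'_1]

theorem pairwise_squares (k m : ℕ) : (squares k m).Pairwise (· ≤ ·) := by
  refine List.pairwise_flatMap.2 ⟨by simp, ?_⟩
  refine (List.pairwise_le_range' (s := k) (n := m)).imp ?_
  simp

theorem unsplit_unsplitWord (n : ℕ) : Unsplit (n + 1) (unsplitWord n) where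
  mem k hk := by
    rw [Finset.mem_Icc] at hk
    simp only [unsplitWord, List.mem_cons, List.mem_append, mem_squares, List.not_mem_nil]
    omega
  ordered := by
    have hle : (0 :: 1 :: 1 :: squares 2 n).Pairwise (· ≤ ·) := by
      simp only [List.pairwise_cons, List.mem_cons, mem_squares]
      exact ⟨by omega, by omega, by omega, pairwise_squares 2 n⟩
    exact List.pairwise_append.2 ⟨hle.imp .inr, by simp, by simp⟩
  guarded := by
    rintro l r hl ⟨_, h1, rfl⟩
    rcases exists_of_append_eq_append_cons (a := 0 :: 1 :: 1 :: squares 2 n) hl with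
      ⟨r', hr'⟩ | ⟨l', rfl, -⟩
    · have h0 : 0 ∉ 1 :: 1 :: squares 2 n := by simp [mem_squares]
      cases l with
      | nil => simp at h1
      | cons i l =>
        rw [(List.cons.inj hr').2] at h0
        simp at h0
    · refine ⟨n + 1, ?_, rfl⟩
      simp only [List.mem_cons, List.mem_append, mem_squares]
      omega

theorem not_unsplit_splitWord {n : ℕ} (hn : n ≠ 0) : ¬ Unsplit (n + 1) (splitWord n) := by
  intro hU
  obtain ⟨k, hk, rfl⟩ := hU.guarded (l := [0, 1, 1]) rfl ⟨1, by simp, rfl⟩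
  simp [hn] at hk

theorem satisfies_separatingIdentity_iff {M : Type*} [Monoid M] {n : ℕ} :
    Satisfies M (separatingIdentity n) ↔ ∀ f : ℕ → M,
      f 0 * (f 1 * (f 1 * (((squares 2 n).map f).prod * f 0))) =
        f 0 * (f 1 * (f 1 * (f 0 * (((squares 2 n).map f).prod * f 0)))) := by
  simp [satisfies_iff_holds, separatingIdentity, Holds, unsplitWord, splitWord]

theorem satisfies_E1_separatingIdentity (n : ℕ) :
    Satisfies (WithOne SemigroupE) (separatingIdentity n) := by
  have hE : ∀ x y q : WithOne SemigroupE,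
      x * (y * (y * (q * x))) = x * (y * (y * (x * (q * x)))) := by decide
  exact satisfies_separatingIdentity_iff.2 fun f => hE _ _ _

namespace SemigroupA

/-- The submonoid `{1, a, b, ba, 0}` of `A¹`, which contains all squares. -/
def squareSubmonoid : Submonoid (WithOne SemigroupA) where
  carrier := {u | u ≠ c ∧ u ≠ bc}
  one_mem' := by decide
  mul_mem' {u v} := by
    revert u v
    decide

theorem mul_self_mem_squareSubmonoid : ∀ u : WithOne SemigroupA, u * u ∈ squareSubmonoid := by
  change ∀ u : WithOne SemigroupA, u * u ≠ c ∧ u * u ≠ bc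
  decide

theorem prod_squares_mem_squareSubmonoid (f : ℕ → WithOne SemigroupA) (k m : ℕ) :
    ((squares k m).map f).prod ∈ squareSubmonoid := by
  rw [squares, prod_map_flatMap]
  refine Submonoid.list_prod_mem _ (List.forall_mem_map.2 fun i _ => ?_)
  simpa using mul_self_mem_squareSubmonoid (f i)

end SemigroupA

theorem satisfies_A1_separatingIdentity (n : ℕ) :
    Satisfies (WithOne SemigroupA) (separatingIdentity n) := by
  have hA : ∀ x y q : WithOne SemigroupA, q ≠ SemigroupA.c ∧ q ≠ SemigroupA.bc →
      x * (y * (y * (q * x))) = x * (y * (y * (x * (q * x)))) := by decide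
  exact satisfies_separatingIdentity_iff.2 fun f =>
    hA _ _ _ (SemigroupA.prod_squares_mem_squareSubmonoid f 2 n)

theorem not_satisfies_unsplitMonoid_separatingIdentity {n : ℕ} (hn : n ≠ 0) :
    ¬ Satisfies (UnsplitMonoid (n + 1)) (separatingIdentity n) := by
  intro h
  have hc := satisfies_quotient_iff.1 h (MonoidHom.id Word) 1 1
  simp only [one_mul, mul_one, MonoidHom.id_apply] at hc
  exact not_unsplit_splitWord hn (hc.1 (unsplit_unsplitWord n))

end SeparatingIdentities

theorem generatedByMonoid_le_iff {S : Type} [Monoid S] {W : MonoidVariety.{u}} :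
    MonoidVariety.generatedByMonoid S ≤ W ↔ W.Mem (ULift.{u} S) := by
  constructor
  · exact fun h => h _ fun X hX => hX _ ⟨MulEquiv.ulift⟩
  · intro hS M _ hM
    refine hM W fun N _ ⟨i⟩ => ?_
    let j : N ≃* ULift.{u} S := i.trans MulEquiv.ulift.symm
    exact W.sub_mem j.toMonoidHom j.injective hS

theorem varA1_sup_varE1_le (n : ℕ) :
    varA1 ⊔ varE1 ≤ MonoidVariety.ofIdentities.{u} {separatingIdentity n} := by
  refine sup_le (generatedByMonoid_le_iff.2 ?_) (generatedByMonoid_le_iff.2 ?_) <;>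
    rintro _ rfl <;> rw [satisfies_congr MulEquiv.ulift]
  exacts [satisfies_A1_separatingIdentity n, satisfies_E1_separatingIdentity n]

theorem exists_forall_length_lt {E : Set Identity} (hE : E.Finite) :
    ∃ n, ∀ e ∈ E, e.1.toList.length < n ∧ e.2.toList.length < n := by
  obtain ⟨n, hn⟩ := (hE.image fun e => max e.1.toList.length e.2.toList.length).bddAbove
  refine ⟨n + 1, fun e he => ?_⟩
  exact max_lt_iff.1 (Nat.lt_succ_of_le (hn ⟨e, he, rfl⟩))

end MonVar

theorem corollary3p3_general (V : MonVar.MonoidVariety.{u}) (hA : MonVar.varA1 ≤ V)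
    (hT : V.Mem (ULift.{u} MonVar.TransitionMonoid))
    (hV : ∀ n, V ≤ MonVar.MonoidVariety.ofIdentities {MonVar.separatingIdentity n}) :
    ¬ V.IsFinitelyBased := by
  rintro ⟨E, hE, rfl⟩
  obtain ⟨n, hn⟩ := MonVar.exists_forall_length_lt hE
  have hmem : (MonVar.MonoidVariety.ofIdentities.{u} E).Mem
      (ULift.{u} (MonVar.UnsplitMonoid (n + 2 + 1))) := by
    intro e he
    rw [MonVar.satisfies_congr MulEquiv.ulift]
    have hAe := (MonVar.satisfies_congr MulEquiv.ulift).1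
      (MonVar.generatedByMonoid_le_iff.1 hA e he)
    have hTe := (MonVar.satisfies_congr MulEquiv.ulift).1 (hT e he)
    obtain ⟨h₁, h₂⟩ := hn e he
    exact MonVar.satisfies_unsplitMonoid hAe hTe (by omega) (by omega)
  have hsep := hV (n + 2) _ hmem _ rfl
  rw [MonVar.satisfies_congr MulEquiv.ulift] at hsep
  exact MonVar.not_satisfies_unsplitMonoid_separatingIdentity (by omega) hsep

theorem corollary3p3 (V : MonVar.MonoidVariety.{u})
    (hlower : MonVar.varA1 ⊔ MonVar.varE1Sigma 2 ≤ V)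
    (hupper : V ≤ MonVar.varA1 ⊔ MonVar.varE1) :
    ¬ V.IsFinitelyBased :=
  corollary3p3_general V (le_sup_left.trans hlower)
    (le_sup_right.trans hlower _ MonVar.TransitionMonoid.mem_varE1Sigma)
    fun n => hupper.trans (MonVar.varA1_sup_varE1_le n)
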